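/- An \emph{arena} is a finite bipartite directed graph $\mathcal A=(V_0,V_1,E)$ with $V_0\cap V_1=\emptyset$, $V=V_0\cup V_1$, $E\subseteq (V_0\times V_1)\cup(V_1\times V_0)$, in which every node has an outgoing edge; write $E(u)=\{v\mid (u,v)\in E\}$. A \emph{play} is an infinite sequence $\rho=v_0,v_1,\dots$ with $v_{i+1}\in E(v_i)$ for all $i$, and $\mathsf{Inf}(\rho)$ is the set of positions occurring infinitely often in $\rho$. A \emph{coloured Muller game} is $\mathcal G=(\mathcal A,c,(\mathcal F_0,\mathcal F_1))$, where $c:V\to C$ maps positions to colours, $\mathcal F_0\cup\mathcal F_1=2^C$ and $\mathcal F_0\cap\mathcal F_1=\emptyset$; Player $\sigma\in\{0,1\}$ wins the play $\rho$ if $c(\mathsf{Inf}(\rho))\in\mathcal F_\sigma$, and $\bar\sigma$ denotes the opponent of $\sigma$. A strategy of Player $\sigma$ assigns to every initial segment $v_0,\dots,v_k$ of a play with $v_k\in V_\sigma$ an element of $E(v_k)$. $Win_\sigma(\mathcal G)$ is the set of $v\in V$ for which Player $\sigma$ has a strategy such that $\sigma$ wins every play from $v$ consistent with it. Player $\sigma$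 \emph{fully wins} $\mathcal G$ if $Win_\sigma(\mathcal G)=V$. For $T\subseteq V$, the $\sigma$-attractor is $Attr_\sigma(T,\mathcal A)=\bigcup_{i\ge 0}W_i$, where $W_0=T$ and $W_{i+1}=W_i\cup\{u\in V_\sigma\mid E(u)\cap W_i\neq\emptyset\}\cup\{u\in V_{\bar\sigma}\mid E(u)\subseteq W_i\}$. If $X\subseteq V$ and every node of $X$ has an outgoing edge into $X$ (as is the case for the complement in $V$ of any attractor), then $\mathcal G(X)$ is the game obtained from $\mathcal G$ by restricting the arena to $(V_0\cap X,V_1\cap X,E\cap(X\times X))$, with the same colouring (restricted to $X$) and the same $\mathcal F_0,\mathcal F_1$. \textbf{Trichotomy Lemma.} Let $\mathcal G$ be a coloured Muller game and let $\sigma\in\{0,1\}$ be such that $c(V)\in\mathcal F_\sigma$. \begin{enumerate} \item Player $\sigma$ fully wins $\mathcal G$ if and only if, for all $c'\in c(V)$, $Attr_\sigma(c^{-1}(c'),\mathcal A)=V$ or Player $\sigma$ fully wins $\mathcal G(V\setminus Attr_\sigma(c^{-1}(c'),\mathcal A))$. \item If the condition in (1) fails, then Player $\bar\sigma$ fully wins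 $\mathcal G$ if and only if, for all $v\in V$, $Attr_{\bar\sigma}(\{v\},\mathcal A)=V$ or Player $\bar\sigma$ fully wins $\mathcal G(V\setminus Attr_{\bar\sigma}(\{v\},\mathcal A))$. \item If the conditions in (1) and (2) both fail, then no player fully wins $\mathcal G$, i.e. $Win_0(\mathcal G)\ne V$ and $Win_1(\mathcal G)\neq V$. \end{enumerate} -/

import Mathlib

namespace RegularGame

/-- A finite arena `(V₀, V₁, E)`: a bipartite directed graph in which every node has an outgoing
edge. The players `0` and `1` are the Booleans `false` and `true`; `pos σ` is the set `V_σ` of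
positions of player `σ`, and `!σ` is the opponent of `σ`. -/
structure Arena (α : Type*) where
  pos : Bool → Set α
  E : α → α → Prop
  finite_pos : ∀ σ, (pos σ).Finite
  disjoint_pos : Disjoint (pos false) (pos true)
  bipartite : ∀ u v, E u v → (u ∈ pos false ∧ v ∈ pos true) ∨ (u ∈ pos true ∧ v ∈ pos false)
  exists_edge : ∀ u ∈ pos false ∪ pos true, ∃ v, E u v

namespace Arena

variable {α : Type*} (A : Arena α)

/-- The set `V = V₀ ∪ V₁` of all positions. -/
def V : Set α := A.pos false ∪ A.pos true

/-- A play: an infinite path. -/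
def IsPlay (ρ : ℕ → α) : Prop := ∀ i, A.E (ρ i) (ρ (i + 1))

/-- The stages `W i` of the computation of the `σ`-attractor of `T`. -/
def attrStage (σ : Bool) (T : Set α) : ℕ → Set α
  | 0 => T
  | i + 1 => attrStage σ T i
      ∪ {u | u ∈ A.pos σ ∧ ∃ v, A.E u v ∧ v ∈ attrStage σ T i}
      ∪ {u | u ∈ A.pos (!σ) ∧ ∀ v, A.E u v → v ∈ attrStage σ T i}

/-- The attractor of player `σ` to `T`. -/
def attr (σ : Bool) (T : Set α) : Set α := ⋃ i, A.attrStage σ T i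

/-- The pseudo-arena `(V₀ ∩ X, V₁ ∩ X, E ∩ (X × X))` determined by `X ⊆ V` is an arena. -/
def IsSubarena (X : Set α) : Prop := X ⊆ A.V ∧ ∀ x ∈ X, ∃ y ∈ X, A.E x y

/-- The subarena determined by `X`. -/
def subarena (X : Set α) (hX : A.IsSubarena X) : Arena α where
  pos σ := A.pos σ ∩ X
  E u v := A.E u v ∧ u ∈ X ∧ v ∈ X
  finite_pos σ := (A.finite_pos σ).inter_of_left X
  disjoint_pos := A.disjoint_pos.mono Set.inter_subset_left Set.inter_subset_left
  bipartite := by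
    rintro u v ⟨h, hu, hv⟩
    rcases A.bipartite u v h with ⟨h0, h1⟩ | ⟨h0, h1⟩
    · exact Or.inl ⟨⟨h0, hu⟩, ⟨h1, hv⟩⟩
    · exact Or.inr ⟨⟨h0, hu⟩, ⟨h1, hv⟩⟩
  exists_edge := by
    intro u hu
    have hx : u ∈ X := by
      rcases hu with h | h
      · exact h.2
      · exact h.2
    obtain ⟨y, hy, he⟩ := hX.2 u hx
    exact ⟨y, he, hx, hy⟩

theorem finite_V : A.V.Finite := (A.finite_pos false).union (A.finite_pos true)

theorem attrStage_mono (σ : Bool) (T : Set α) : Monotone (A.attrStage σ T) :=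
  monotone_nat_of_le_succ fun _ _ hx => Or.inl (Or.inl hx)

theorem snd_mem_V {u v : α} (h : A.E u v) : v ∈ A.V := by
  rcases A.bipartite u v h with ⟨_, h⟩ | ⟨_, h⟩
  · exact Or.inr h
  · exact Or.inl h

/-- The complement of an attractor determines a subarena. -/
theorem isSubarena_diff_attr (σ : Bool) (T : Set α) : A.IsSubarena (A.V \ A.attr σ T) := by
  refine ⟨Set.sdiff_subset, ?_⟩
  rintro x ⟨hxV, hx⟩
  have hx' : x ∈ A.pos σ ∨ x ∈ A.pos (!σ) := by
    cases σ
    · exact hxV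
    · exact hxV.symm
  by_contra hcon
  have hall : ∀ y, A.E x y → y ∈ A.attr σ T := by
    intro y hy
    by_contra hny
    exact hcon ⟨y, ⟨A.snd_mem_V hy, hny⟩, hy⟩
  apply hx
  rcases hx' with h | h
  · obtain ⟨y, hy⟩ := A.exists_edge x hxV
    obtain ⟨i, hi⟩ := Set.mem_iUnion.1 (hall y hy)
    exact Set.mem_iUnion.2 ⟨i + 1, Or.inl (Or.inr ⟨h, y, hy, hi⟩)⟩
  · have hfin : {y | A.E x y}.Finite := A.finite_V.subset fun y hy => A.snd_mem_V hy
    have hsub : (hfin.toFinset : Set α) ⊆ ⋃ i, A.attrStage σ T i := fun y hy => hall y (by simpa using hy)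
    obtain ⟨i, hi⟩ := (A.attrStage_mono σ T).directed_le.exists_mem_subset_of_finset_subset_biUnion hsub
    exact Set.mem_iUnion.2 ⟨i + 1, Or.inr ⟨h, fun y hy => hi (by simpa using hy)⟩⟩

/-- The initial segment `v₀, …, v_k` of a sequence. -/
def initSeg (ρ : ℕ → α) (k : ℕ) : List α := (List.range (k + 1)).map ρ

/-- A strategy of player `σ`: to every initial segment `v₀, …, v_k` of a play with `v_k ∈ V_σ`
it assigns a successor of `v_k`. (Its values on other lists are irrelevant.) -/
structure Strategy (σ : Bool) where
  next : List α → α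
  legal : ∀ ρ k, A.IsPlay ρ → ρ k ∈ A.pos σ → A.E (ρ k) (next (initSeg ρ k))

/-- The sequence `ρ` is consistent with the strategy `s` of player `σ`. -/
def Strategy.Consistent {A : Arena α} {σ : Bool} (s : A.Strategy σ) (ρ : ℕ → α) : Prop :=
  ∀ k, ρ k ∈ A.pos σ → ρ (k + 1) = s.next (initSeg ρ k)

end Arena

/-- The infinity set of a sequence of positions. -/
def infSet {α : Type*} (ρ : ℕ → α) : Set α := {v | {i | ρ i = v}.Infinite}

/-- A coloured Muller game `(A, c, (F₀, F₁))`, where `C` is the set of colours.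
(Only the values of `c` on the positions of the arena matter.) -/
structure ColouredMullerGame (α C : Type*) where
  arena : Arena α
  c : α → C
  F : Bool → Set (Set C)
  union_F : F false ∪ F true = Set.univ
  inter_F : F false ∩ F true = ∅

namespace ColouredMullerGame

variable {α C : Type*} (G : ColouredMullerGame α C)

/-- The set of positions of the game. -/
def V : Set α := G.arena.V

/-- The set `c⁻¹(c')` of positions coloured `c'`. -/
def colourClass (c' : C) : Set α := {v | v ∈ G.V ∧ G.c v = c'}

/-- Player `σ` wins the play `ρ`. -/
def WinsPlay (σ : Bool) (ρ : ℕ → α) : Prop := G.c '' infSet ρ ∈ G.F σ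

/-- The winning region of player `σ`: the positions `v` such that `σ` has a strategy which wins
every play from `v` that is consistent with it. -/
def Win (σ : Bool) : Set α :=
  {v | v ∈ G.V ∧ ∃ s : G.arena.Strategy σ, ∀ ρ : ℕ → α,
    G.arena.IsPlay ρ → ρ 0 = v → s.Consistent ρ → G.WinsPlay σ ρ}

/-- Player `σ` fully wins the game. -/
def FullyWins (σ : Bool) : Prop := G.Win σ = G.V

/-- No player fully wins the game. -/
def NoPlayerFullyWins : Prop := ∀ σ, ¬ G.FullyWins σ

/-- The subgame `G(X)` played on the subarena determined by `X`. -/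
def subgame (X : Set α) (hX : G.arena.IsSubarena X) : ColouredMullerGame α C where
  arena := G.arena.subarena X hX
  c := G.c
  F := G.F
  union_F := G.union_F
  inter_F := G.inter_F

/-- The subgame `G(V \ Attr_σ(T))`. -/
def outsideAttr (σ : Bool) (T : Set α) : ColouredMullerGame α C :=
  G.subgame (G.V \ G.arena.attr σ T) (G.arena.isSubarena_diff_attr σ T)

end ColouredMullerGame

end RegularGame

/-! Let σ own the full colour set. For (1), σ cycles through the colours: attract to the current
colour inside its attractor, win the subgame outside. Either every colour recurs, and σ owns that
set, or the play ends up in one won subgame. Conversely, σ cannot move into a σ-attractor from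
outside, so winning strategies restrict to the complement. For (2), determinacy gives a vertex v won
by the opponent, who attracts to v or wins outside its attractor. (3) is then formal. Determinacy is
by induction on the number of positions: if the opponent's region is nonempty, remove its attractor;
if empty, σ wins outside every colour attractor, and (1) applies. Both constructions of strategies
are instances of `mem_Win_of_phases`. -/

namespace RegularGame

/-! ### Paths, strategies and attractors -/

namespace Arena

variable {α : Type*} (A : Arena α)

theorem fst_mem_V {u v : α} (h : A.E u v) : u ∈ A.V := by
  rcases A.bipartite u v h with ⟨h, _⟩ | ⟨h, _⟩
  · exact Or.inl h
  · exact Or.inr h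

theorem pos_subset_V (σ : Bool) : A.pos σ ⊆ A.V := by
  cases σ
  · exact Set.subset_union_left
  · exact Set.subset_union_right

theorem mem_pos_or {u : α} (h : u ∈ A.V) (σ : Bool) : u ∈ A.pos σ ∨ u ∈ A.pos (!σ) := by
  cases σ
  · exact h
  · exact h.symm

theorem IsPlay.mem_V {A : Arena α} {ρ : ℕ → α} (h : A.IsPlay ρ) (k : ℕ) : ρ k ∈ A.V :=
  A.fst_mem_V (h k)

theorem subarena_V (X : Set α) (hX : A.IsSubarena X) : (A.subarena X hX).V = X := by
  ext u
  constructor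
  · rintro (h | h) <;> exact h.2
  · intro h
    rcases hX.1 h with h' | h'
    · exact Or.inl ⟨h', h⟩
    · exact Or.inr ⟨h', h⟩

theorem initSeg_succ (ρ : ℕ → α) (k : ℕ) : initSeg ρ (k + 1) = initSeg ρ k ++ [ρ (k + 1)] := by
  simp [initSeg, List.range_succ]

theorem initSeg_getLastD (ρ : ℕ → α) (k : ℕ) (d : α) : (initSeg ρ k).getLastD d = ρ k := by
  simp [initSeg, List.range_succ]

theorem initSeg_head? (ρ : ℕ → α) (k : ℕ) : (initSeg ρ k).head? = some (ρ 0) := by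
  induction k with
  | zero => rfl
  | succ k ih => rw [initSeg_succ, List.head?_append, ih]; rfl

theorem initSeg_congr {ρ ρ' : ℕ → α} {k : ℕ} (h : ∀ i ≤ k, ρ i = ρ' i) :
    initSeg ρ k = initSeg ρ' k := by
  refine List.map_congr_left fun i hi => h i ?_
  have := List.mem_range.1 hi
  omega

/-- Every finite path extends to a play. -/
theorem exists_isPlay_extending {ρ : ℕ → α} {k : ℕ} (hk : ρ k ∈ A.V)
    (h : ∀ i < k, A.E (ρ i) (ρ (i + 1))) : ∃ ρ', A.IsPlay ρ' ∧ ∀ i ≤ k, ρ i = ρ' i := by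
  classical
  have hs : ∀ u : α, ∃ v, u ∈ A.V → A.E u v := fun u => by
    by_cases hu : u ∈ A.V
    · obtain ⟨v, hv⟩ := A.exists_edge u hu
      exact ⟨v, fun _ => hv⟩
    · exact ⟨u, fun h => absurd h hu⟩
  choose f hf using hs
  have hV : ∀ i, f^[i] (ρ k) ∈ A.V := by
    intro i
    induction i with
    | zero => exact hk
    | succ i ih => rw [Function.iterate_succ_apply']; exact A.snd_mem_V (hf _ ih)
  refine ⟨fun i => if i ≤ k then ρ i else f^[i - k] (ρ k), fun i => ?_, fun i hi => by simp [hi]⟩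
  rcases lt_trichotomy i k with hi | rfl | hi
  · simpa [hi.le, Nat.succ_le_of_lt hi] using h i hi
  · simpa using hf _ hk
  · have h1 : ¬ i ≤ k := by omega
    have h2 : ¬ i + 1 ≤ k := by omega
    have h3 : i + 1 - k = (i - k) + 1 := by omega
    simp only [h1, h2, if_false, h3, Function.iterate_succ_apply']
    exact hf _ (hV _)

/-- Legality is postulated along plays only, so the path is extended to a play. Needed when a
sequence is known to stay in a subgame only up to time `k`. -/
theorem Strategy.legal_of_path {A : Arena α} {σ : Bool} (s : A.Strategy σ) {ρ : ℕ → α} {k : ℕ}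
    (hk : ρ k ∈ A.pos σ) (h : ∀ i < k, A.E (ρ i) (ρ (i + 1))) :
    A.E (ρ k) (s.next (initSeg ρ k)) := by
  obtain ⟨ρ', hρ', he⟩ := A.exists_isPlay_extending (A.pos_subset_V σ hk) h
  rw [initSeg_congr he, he k le_rfl]
  exact s.legal ρ' k hρ' (he k le_rfl ▸ hk)

theorem subset_attr (σ : Bool) (T : Set α) : T ⊆ A.attr σ T :=
  fun _ hu => Set.mem_iUnion.2 ⟨0, hu⟩

theorem attrStage_subset_V {σ : Bool} {T : Set α} (hT : T ⊆ A.V) (i : ℕ) :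
    A.attrStage σ T i ⊆ A.V := by
  induction i with
  | zero => exact hT
  | succ i ih =>
    rintro u ((h | h) | h)
    · exact ih h
    · exact A.pos_subset_V _ h.1
    · exact A.pos_subset_V _ h.1

theorem attr_subset_V {σ : Bool} {T : Set α} (hT : T ⊆ A.V) : A.attr σ T ⊆ A.V :=
  Set.iUnion_subset fun i => A.attrStage_subset_V hT i

theorem attr_empty (σ : Bool) : A.attr σ ∅ = ∅ := by
  refine Set.iUnion_eq_empty.2 fun i => ?_
  induction i with
  | zero => rfl
  | succ i ih =>
    refine Set.eq_empty_of_forall_notMem ?_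
    simp only [attrStage, ih]
    rintro u ((h | ⟨_, v, _, h⟩) | ⟨hu, h⟩)
    · exact h
    · exact h
    · obtain ⟨v, hv⟩ := A.exists_edge u (A.pos_subset_V _ hu)
      exact h v hv

/-- Player `σ` cannot leave the complement of a `σ`-attractor. -/
theorem notMem_attr_of_edge {σ : Bool} {T : Set α} {u v : α} (hu : u ∈ A.pos σ)
    (h : u ∉ A.attr σ T) (he : A.E u v) : v ∉ A.attr σ T := by
  intro hv
  obtain ⟨i, hi⟩ := Set.mem_iUnion.1 hv
  exact h (Set.mem_iUnion.2 ⟨i + 1, Or.inl (Or.inr ⟨hu, v, he, hi⟩)⟩)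

/-- A positional attractor strategy: every move according to it decreases the stage. -/
theorem exists_attractor_move (σ : Bool) (T : Set α) :
    ∃ g : α → α, ∀ i u w, u ∈ A.attrStage σ T (i + 1) → u ∉ A.attrStage σ T i → A.E u w →
      (u ∈ A.pos σ → A.E u (g u) → w = g u) → w ∈ A.attrStage σ T i := by
  have key : ∀ u, ∃ x, ∀ i w, u ∈ A.attrStage σ T (i + 1) → u ∉ A.attrStage σ T i → A.E u w →
      (u ∈ A.pos σ → A.E u x → w = x) → w ∈ A.attrStage σ T i := by
    intro u
    by_cases hex : ∃ i v, u ∈ A.attrStage σ T (i + 1) ∧ u ∉ A.attrStage σ T i ∧ u ∈ A.pos σ ∧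
        A.E u v ∧ v ∈ A.attrStage σ T i
    · obtain ⟨i, v, h1, h2, h3, h4, h5⟩ := hex
      refine ⟨v, fun j w hj1 hj2 _ hw => ?_⟩
      -- A node enters the stages only once, so the move chosen for one index serves for all.
      have hij : i ≤ j := by
        by_contra hlt
        exact h2 (A.attrStage_mono σ T (by omega : j + 1 ≤ i) hj1)
      rw [hw h3 h4]
      exact A.attrStage_mono σ T hij h5
    · refine ⟨u, fun i w h1 h2 hw _ => ?_⟩
      rcases h1 with (h | ⟨h, v, hv, hv'⟩) | ⟨_, h⟩
      · exact absurd h h2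
      · exact absurd ⟨i, v, Or.inl (Or.inr ⟨h, v, hv, hv'⟩), h2, h, hv, hv'⟩ hex
      · exact h w hw
  choose g hg using key
  exact ⟨g, fun i u w => hg u i w⟩

theorem exists_stage_of_mem_attr {σ : Bool} {T : Set α} {u : α} (h : u ∈ A.attr σ T)
    (hT : u ∉ T) : ∃ i, u ∈ A.attrStage σ T (i + 1) ∧ u ∉ A.attrStage σ T i := by
  obtain ⟨i, hi⟩ := Set.mem_iUnion.1 h
  induction i with
  | zero => exact absurd hi hT
  | succ i ih =>
    by_cases h' : u ∈ A.attrStage σ T i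
    · exact ih h'
    · exact ⟨i, hi, h'⟩

end Arena

theorem infSet_shift {α : Type*} (ρ : ℕ → α) (j : ℕ) : infSet (fun i => ρ (j + i)) = infSet ρ := by
  ext v
  simp only [infSet, Set.mem_ofPred_eq, Set.infinite_iff_exists_gt]
  constructor
  · intro h a
    obtain ⟨b, hb, hab⟩ := h a
    exact ⟨j + b, hb, by omega⟩
  · intro h a
    obtain ⟨b, hb, hab⟩ := h (j + a)
    exact ⟨b - j, by simpa [show j + (b - j) = b by omega] using hb, by omega⟩

/-! ### Strategies with memory; transfer between game and subgame -/

namespace ColouredMullerGame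

open Arena

variable {α C : Type*} (G : ColouredMullerGame α C)

theorem Win_subset_V (σ : Bool) : G.Win σ ⊆ G.V := fun _ h => h.1

theorem outsideAttr_V (σ : Bool) (T : Set α) :
    (G.outsideAttr σ T).V = G.V \ G.arena.attr σ T :=
  G.arena.subarena_V _ (G.arena.isSubarena_diff_attr σ T)

/-- A strategy with memory in `M` witnesses membership in the winning region; illegal moves that
it proposes are ignored. -/
theorem mem_Win_of_memory {σ : Bool} {v : α} (hv : v ∈ G.V) {M : Type*} (m₀ : M)
    (upd : M → α → M) (g : M → α → α)
    (H : ∀ (ρ : ℕ → α) (m : ℕ → M), G.arena.IsPlay ρ → ρ 0 = v → m 0 = upd m₀ (ρ 0) →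
      (∀ k, m (k + 1) = upd (m k) (ρ (k + 1))) →
      (∀ k, ρ k ∈ G.arena.pos σ → G.arena.E (ρ k) (g (m k) (ρ k)) →
        ρ (k + 1) = g (m k) (ρ k)) → G.WinsPlay σ ρ) :
    v ∈ G.Win σ := by
  classical
  let f : List α → α := fun h => g (h.foldl upd m₀) (h.getLastD v)
  let s : G.arena.Strategy σ :=
    { next := fun h =>
        if G.arena.E (h.getLastD v) (f h) then f h
        else if hex : ∃ w, G.arena.E (h.getLastD v) w then hex.choose else v
      legal := by
        intro ρ k hρ _
        simp only [initSeg_getLastD]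
        split_ifs with h1 h2
        · exact h1
        · exact h2.choose_spec
        · exact absurd ⟨_, hρ k⟩ h2 }
  refine ⟨hv, s, fun ρ hρ h0 hs => H ρ (fun k => (initSeg ρ k).foldl upd m₀) hρ h0 rfl
    (fun k => by rw [initSeg_succ, List.foldl_append]; rfl) fun k hk hE => ?_⟩
  have hf : f (initSeg ρ k) = g ((initSeg ρ k).foldl upd m₀) (ρ k) := by
    simp only [f, initSeg_getLastD]
  rw [hs k hk]
  simp only [s, initSeg_getLastD, hf, hE, if_true]

/-- Winning positions outside a `σ`-attractor remain winning for `σ` in the subgame. -/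
theorem Win_diff_attr_subset (σ : Bool) (T : Set α) :
    G.Win σ \ G.arena.attr σ T ⊆ (G.outsideAttr σ T).Win σ := by
  rintro v ⟨⟨hv, s, hs⟩, hva⟩
  have hplay : ∀ ρ, (G.outsideAttr σ T).arena.IsPlay ρ → G.arena.IsPlay ρ :=
    fun ρ hρ i => (hρ i).1
  refine ⟨by rw [outsideAttr_V]; exact ⟨hv, hva⟩, ⟨s.next, fun ρ k hρ hk => ?_⟩,
    fun ρ hρ h0 hc => ?_⟩
  · have hE := s.legal ρ k (hplay ρ hρ) hk.1
    exact ⟨hE, hk.2, G.arena.snd_mem_V hE, G.arena.notMem_attr_of_edge hk.1 hk.2.2 hE⟩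
  · exact hs ρ (hplay ρ hρ) h0 fun k hk => hc k ⟨hk, (hρ k).2.1⟩

/-- The opponent's winning positions in the complement of a `σ`-attractor, which is a trap for
`σ`, are winning in the whole game. -/
theorem Win_not_outsideAttr_subset (σ : Bool) (T : Set α) :
    (G.outsideAttr σ T).Win (!σ) ⊆ G.Win (!σ) := by
  rintro v ⟨hv, s, hs⟩
  rw [outsideAttr_V] at hv
  refine G.mem_Win_of_memory hv.1 ([] : List α) (fun h u => h ++ [u]) (fun h _ => s.next h) ?_
  intro ρ m hρ h0 hm0 hm hc
  have hm' : ∀ k, m k = initSeg ρ k := by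
    intro k
    induction k with
    | zero => exact hm0
    | succ k ih => rw [hm, ih, initSeg_succ]
  -- Joint induction: the subgame strategy is legal at time `k` only if the path so far lies in the
  -- subgame.
  have key : ∀ k, ρ k ∉ G.arena.attr σ T ∧
      ∀ i < k, (G.outsideAttr σ T).arena.E (ρ i) (ρ (i + 1)) := by
    intro k
    induction k with
    | zero => exact ⟨h0 ▸ hv.2, fun i hi => absurd hi (Nat.not_lt_zero i)⟩
    | succ k ih =>
      have hX : ρ k ∈ G.V \ G.arena.attr σ T := ⟨hρ.mem_V k, ih.1⟩
      have hnext : ρ (k + 1) ∉ G.arena.attr σ T := by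
        rcases G.arena.mem_pos_or (hρ.mem_V k) σ with hk | hk
        · exact G.arena.notMem_attr_of_edge hk ih.1 (hρ k)
        · have hE := s.legal_of_path (ρ := ρ) (k := k) ⟨hk, hX⟩ ih.2
          rw [hc k hk (by rw [hm']; exact hE.1), hm']
          exact hE.2.2.2
      refine ⟨hnext, fun i hi => ?_⟩
      rcases Nat.lt_succ_iff_lt_or_eq.1 hi with hi | rfl
      · exact ih.2 i hi
      · exact ⟨hρ i, hX, hρ.mem_V _, hnext⟩
  have hsub : (G.outsideAttr σ T).arena.IsPlay ρ := fun i => (key (i + 1)).2 i (Nat.lt_succ_self i)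
  refine hs ρ hsub h0 fun k hk => ?_
  have hE := s.legal ρ k hsub hk
  rw [hc k hk.1 (by rw [hm']; exact hE.1), hm']

/-! ### Strategies composed of phases -/

theorem winsPlay_shift {σ : Bool} {ρ : ℕ → α} (j : ℕ) :
    G.WinsPlay σ (fun i => ρ (j + i)) ↔ G.WinsPlay σ ρ := by
  rw [WinsPlay, WinsPlay, infSet_shift]

/-- Player `σ` plays in phases. Phase `n` begins in `P n` and ends when `T n` is reached. Inside the
attractor of `T n`, Player `σ` attracts to `T n`; outside, a strategy winning the subgame is played.
If every play that goes through all phases is won, then so is every play. -/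
theorem mem_Win_of_phases {σ : Bool} (T P : ℕ → Set α) {v : α} (hv : v ∈ G.V) (hv0 : v ∈ P 0)
    (hTP : ∀ n, T n ⊆ P (n + 1))
    (hP : ∀ n, P n ⊆ G.arena.attr σ (T n) ∪ (G.outsideAttr σ (T n)).Win σ)
    (hstep : ∀ n, ∀ u ∈ T n, u ∈ T (n + 1) → ∀ w, G.arena.E u w → w ∈ P (n + 1))
    (hall : ∀ ρ, G.arena.IsPlay ρ → (∃ k : ℕ → ℕ, StrictMono k ∧ ∀ n, ρ (k n) ∈ T n) →
      G.WinsPlay σ ρ) :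
    v ∈ G.Win σ := by
  classical
  choose a ha using fun n => G.arena.exists_attractor_move σ (T n)
  -- A winning strategy depends on the starting position, so one is fixed for each phase and entry
  -- point `u`.
  have hsel : ∀ n u, ∃ f : List α → α, u ∈ (G.outsideAttr σ (T n)).Win σ →
      ∀ ρ, (G.outsideAttr σ (T n)).arena.IsPlay ρ → ρ 0 = u →
      (∀ k, ρ k ∈ G.arena.pos σ → G.arena.E (ρ k) (f (initSeg ρ k)) →
        ρ (k + 1) = f (initSeg ρ k)) → G.WinsPlay σ ρ := by
    intro n u
    by_cases hu : u ∈ (G.outsideAttr σ (T n)).Win σ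
    · obtain ⟨s, hs⟩ := hu.2
      exact ⟨s.next, fun _ ρ hρ h0 hc => hs ρ hρ h0 fun k hk =>
        hc k hk.1 (s.legal ρ k hρ hk).1⟩
    · exact ⟨fun _ => u, fun h => absurd h hu⟩
  choose f hf using hsel
  let nxt : ℕ → α → ℕ := fun n u => if u ∈ T n then n + 1 else n
  -- The memory holds the phase and the history since the subgame was entered; the head of the
  -- history is the entry point.
  let upd : ℕ × List α → α → ℕ × List α := fun m u =>
    (nxt m.1 u, if u ∈ G.arena.attr σ (T (nxt m.1 u)) then []
      else (if u ∈ T m.1 then [] else m.2) ++ [u])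
  let g : ℕ × List α → α → α := fun m u =>
    if u ∈ G.arena.attr σ (T m.1) then a m.1 u else f m.1 (m.2.head?.getD u) m.2
  refine G.mem_Win_of_memory hv ((0, []) : ℕ × List α) upd g ?_
  intro ρ m hρ h0 hm0 hm hc
  -- `N k` is the phase before position `ρ k` is taken into account
  let N : ℕ → ℕ := fun k => match k with
    | 0 => 0
    | k + 1 => (m k).1
  have hN : ∀ k, N (k + 1) = nxt (N k) (ρ k) := by
    intro k
    cases k with
    | zero => exact congrArg Prod.fst hm0
    | succ k => exact congrArg Prod.fst (hm k)
  have hmN : ∀ k, (m k).1 = N (k + 1) := fun _ => rfl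
  have hNmono : Monotone N := monotone_nat_of_le_succ fun k => by
    rw [hN]; simp only [nxt]; split_ifs <;> omega
  by_cases hunb : ∀ n, ∃ k, n < N k
  · -- all phases are completed
    have hhit : ∀ n, ∃ k, N k = n ∧ N (k + 1) = n + 1 := by
      intro n
      have hex := hunb n
      have h1 := Nat.find_spec hex
      have h2 : Nat.find hex ≠ 0 := fun h => by rw [h] at h1; exact absurd h1 (Nat.not_lt_zero n)
      obtain ⟨k, hk⟩ := Nat.exists_eq_succ_of_ne_zero h2
      have h3 := Nat.find_min hex (m := k) (by omega)
      rw [hk, Nat.succ_eq_add_one] at h1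
      refine ⟨k, ?_⟩
      have h4 := hN k
      simp only [nxt] at h4
      split_ifs at h4 <;> omega
    choose k hk1 hk2 using hhit
    refine hall ρ hρ ⟨k, strictMono_nat_of_lt_succ fun n => ?_, fun n => ?_⟩
    · by_contra hle
      have := hNmono (not_lt.1 hle)
      rw [hk1, hk1] at this
      omega
    · have h4 := hN (k n)
      simp only [nxt] at h4
      rw [hk1, hk2] at h4
      by_contra hn
      simp [hn] at h4
  · -- the phase is eventually constant
    push Not at hunb
    have hconst : ∃ K, ∀ k, K ≤ k → N (k + 1) = N (K + 1) := by
      obtain ⟨b, hb⟩ := hunb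
      have hfin : (Set.range N).Finite := (Set.finite_Iic b).subset (by rintro _ ⟨k, rfl⟩; exact hb k)
      obtain ⟨_, ⟨K, rfl⟩, hK⟩ := hfin.exists_maximal (Set.range_nonempty N)
      refine ⟨K, fun k hk => le_antisymm ?_ (hNmono (Nat.succ_le_succ hk))⟩
      exact (hK ⟨k + 1, rfl⟩ (hNmono (hk.trans k.le_succ))).trans (hNmono K.le_succ)
    -- With `K` least, either `K = 0` or reading `ρ K` ended the previous phase; hence `ρ K ∈ P n`.
    have hK := Nat.find_spec hconst
    have hKmin : ∀ {j}, j < Nat.find hconst → ¬ ∀ k, j ≤ k → N (k + 1) = N (j + 1) :=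
      fun h => Nat.find_min hconst h
    generalize Nat.find hconst = K at hK hKmin
    set n := N (K + 1) with hn
    -- Strict, because a position advances the phase only once: `ρ K` may already lie in `T n`.
    have hnotT : ∀ k, K < k → ρ k ∉ T n := by
      intro k hk hT
      obtain ⟨j, rfl⟩ : ∃ j, k = j + 1 := ⟨k - 1, by omega⟩
      have h1 := hK (j + 1) (by omega)
      rw [hN, hK j (by omega)] at h1
      simp [nxt, hT] at h1
    obtain ⟨hPK, hK0⟩ : ρ K ∈ P n ∧
        (K = 0 ∧ ρ K ∉ T n ∨ ρ K ∈ T (N K) ∧ n = N K + 1) := by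
      by_cases hT : ρ K ∈ T (N K)
      · have h1 : n = N K + 1 := by rw [hn, hN]; simp [nxt, hT]
        exact ⟨h1 ▸ hTP _ hT, Or.inr ⟨hT, h1⟩⟩
      · have h1 : n = N K := by rw [hn, hN]; simp [nxt, hT]
        rcases Nat.eq_zero_or_pos K with rfl | hpos
        · refine ⟨?_, Or.inl ⟨rfl, h1 ▸ hT⟩⟩
          rw [h1, h0]
          exact hv0
        · exfalso
          obtain ⟨j, rfl⟩ : ∃ j, K = j + 1 := ⟨K - 1, by omega⟩
          refine hKmin (Nat.lt_succ_self j) fun k hk => ?_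
          rcases hk.eq_or_lt with rfl | hk
          · rfl
          · rw [hK k hk, h1]
    have hphase : ∀ k, K ≤ k → (m k).1 = n := fun k hk => by rw [hmN]; exact hK k hk
    have hdesc : ∀ k, K ≤ k → ∀ i, ρ k ∈ G.arena.attrStage σ (T n) (i + 1) →
        ρ k ∉ G.arena.attrStage σ (T n) i → ρ (k + 1) ∈ G.arena.attrStage σ (T n) i := by
      intro k hk i h1 h2
      refine ha n i (ρ k) _ h1 h2 (hρ k) fun hpos hE => ?_
      have hat : ρ k ∈ G.arena.attr σ (T n) := Set.mem_iUnion.2 ⟨_, h1⟩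
      have hg : g (m k) (ρ k) = a n (ρ k) := by simp [g, hphase k hk, hat]
      rw [hc k hpos (by rw [hg]; exact hE), hg]
    -- Inside the attractor the stage would drop until `T n` is hit.
    have hout : ∀ k, K < k → ρ k ∉ G.arena.attr σ (T n) := by
      have : ∀ i k, K < k → ρ k ∉ G.arena.attrStage σ (T n) i := by
        intro i
        induction i with
        | zero => exact hnotT
        | succ i ih =>
          exact fun k hk h => ih (k + 1) (by omega) (hdesc k hk.le i h (ih k hk))
      intro k hk h
      obtain ⟨i, hi⟩ := Set.mem_iUnion.1 h
      exact this i k hk hi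
    -- from time `J` on, the play stays in the subgame
    obtain ⟨J, hKJ, hPJ, hmJ, hJ⟩ : ∃ J, K ≤ J ∧ ρ J ∈ P n ∧ (m J).2 = [ρ J] ∧
        ∀ k, J ≤ k → ρ k ∉ G.arena.attr σ (T n) := by
      -- If so, `ρ K` must lie in `T n` itself, and `hstep` puts its successor in `P n`.
      by_cases hat : ρ K ∈ G.arena.attr σ (T n)
      · refine ⟨K + 1, by omega, ?_, ?_, fun k hk => hout k hk⟩
        · by_cases hT : ρ K ∈ T n
          · obtain ⟨hTK, h1⟩ := hK0.resolve_left fun h => h.2 hT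
            exact h1 ▸ hstep (N K) _ hTK (h1 ▸ hT) _ (hρ K)
          · obtain ⟨i, h1, h2⟩ := G.arena.exists_stage_of_mem_attr hat hT
            exact absurd (Set.mem_iUnion.2 ⟨i, hdesc K le_rfl i h1 h2⟩) (hout (K + 1) (by omega))
        · have hmK : (m K).2 = [] := by
            have h1 : (nxt (N K) (ρ K)) = n := by rw [← hN]
            cases K with
            | zero => rw [hm0]; exact if_pos (by rw [h1]; exact hat)
            | succ k => rw [hm]; exact if_pos (by rw [show (m k).1 = N (k + 1) from rfl, h1]; exact hat)
          have hT := hnotT (K + 1) (by omega)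
          have h2 := hout (K + 1) (by omega)
          rw [hm]
          simp only [upd, nxt, hphase K le_rfl, hT, if_false, h2, hmK, List.nil_append]
      · refine ⟨K, le_rfl, hPK, ?_, fun k hk => ?_⟩
        · have h1 : (nxt (N K) (ρ K)) = n := by rw [← hN]
          cases K with
          | zero =>
            rw [hm0]
            refine (if_neg (by rw [h1]; exact hat)).trans ?_
            split_ifs <;> rfl
          | succ k =>
            have hTk : ρ (k + 1) ∈ T (m k).1 := (hK0.resolve_left fun h => k.succ_ne_zero h.1).1
            rw [hm]
            refine (if_neg (by rw [show (m k).1 = N (k + 1) from rfl, h1]; exact hat)).trans ?_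
            rw [if_pos hTk, List.nil_append]
        · rcases hk.eq_or_lt with rfl | hk
          · exact hat
          · exact hout k hk
    have hhist : ∀ i, (m (J + i)).2 = initSeg (fun i => ρ (J + i)) i := by
      intro i
      induction i with
      | zero => exact hmJ
      | succ i ih =>
        have hT := hnotT (J + i + 1) (by omega)
        have h2 := hJ (J + i + 1) (by omega)
        rw [initSeg_succ, ← add_assoc, hm]
        simp only [upd, nxt, hphase (J + i) (by omega), hT, if_false, h2, ih]
    have hwin : ρ J ∈ (G.outsideAttr σ (T n)).Win σ :=
      (hP n hPJ).resolve_left (hJ J le_rfl)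
    refine (G.winsPlay_shift J).1 (hf n (ρ J) hwin _ (fun i => ?_) rfl fun i hpos hE => ?_)
    · exact ⟨hρ (J + i), ⟨hρ.mem_V _, hJ _ (by omega)⟩, hρ.mem_V _, hJ _ (by omega)⟩
    · have hg : g (m (J + i)) (ρ (J + i)) = f n (ρ J) (initSeg (fun i => ρ (J + i)) i) := by
        simp only [g, hphase (J + i) (by omega), hJ (J + i) (by omega), if_false, hhist,
          initSeg_head?, add_zero, Option.getD_some]
      rw [← hg]
      exact hc (J + i) hpos (by rw [hg]; exact hE)

/-- If `σ` wins from `T`, then `σ` wins from the attractor of `T` and from the positions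
winning in the subgame outside this attractor. -/
theorem attr_union_Win_subset {σ : Bool} {T : Set α} (hT : T ⊆ G.Win σ) :
    G.arena.attr σ T ∪ (G.outsideAttr σ T).Win σ ⊆ G.Win σ := by
  intro v hv
  have hvV : v ∈ G.V := by
    rcases hv with hv | hv
    · exact G.arena.attr_subset_V (hT.trans (G.Win_subset_V σ)) hv
    · have := hv.1
      rw [outsideAttr_V] at this
      exact this.1
  -- After `T` is reached the target is `∅`, whose attractor is empty: the last phase is the whole
  -- game, won from `T`.
  refine G.mem_Win_of_phases
    (fun n => match n with
      | 0 => T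
      | _ + 1 => ∅)
    (fun n => match n with
      | 0 => G.arena.attr σ T ∪ (G.outsideAttr σ T).Win σ
      | _ + 1 => T) hvV hv ?_ ?_ ?_ ?_
  · rintro (_ | n)
    · exact subset_rfl
    · exact Set.empty_subset _
  · rintro (_ | n) u hu
    · exact hu
    · refine Or.inr (G.Win_diff_attr_subset σ ∅ ⟨hT hu, ?_⟩)
      rw [attr_empty]
      exact Set.notMem_empty u
  · exact fun n u _ huT => absurd huT (Set.notMem_empty u)
  · rintro ρ _ ⟨k, _, hk⟩
    exact absurd (hk 1) (Set.notMem_empty _)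

/-- If outside the attractor of every colour class `σ` fully wins, and the set of all colours is
winning for `σ`, then `σ` fully wins. -/
theorem fullyWins_of_colours {σ : Bool} (hσ : G.c '' G.V ∈ G.F σ)
    (h : ∀ c' ∈ G.c '' G.V, (G.outsideAttr σ (G.colourClass c')).FullyWins σ) :
    G.FullyWins σ := by
  refine Set.Subset.antisymm (G.Win_subset_V σ) fun v hv => ?_
  have hfin : (G.c '' G.V).Finite := G.arena.finite_V.image _
  obtain ⟨e, he⟩ := hfin.countable.exists_eq_range ⟨_, v, hv, rfl⟩
  have hT : ∀ n, G.colourClass (e n) ⊆ G.V := fun n u hu => hu.1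
  -- `n.unpair.1` takes each value infinitely often, so every colour is targeted infinitely often.
  refine G.mem_Win_of_phases (fun n => G.colourClass (e n.unpair.1)) (fun _ => G.V) hv hv
    (fun n => hT _) (fun n u hu => ?_) (fun _ _ _ _ w hw => G.arena.snd_mem_V hw) ?_
  · by_cases hat : u ∈ G.arena.attr σ (G.colourClass (e n.unpair.1))
    · exact Or.inl hat
    · right
      have := h (e n.unpair.1) (he ▸ ⟨_, rfl⟩)
      rw [this, outsideAttr_V]
      exact ⟨hu, hat⟩
  · rintro ρ hρ ⟨k, hk, hkT⟩
    have hcol : G.c '' infSet ρ = G.c '' G.V := by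
      refine Set.Subset.antisymm (Set.image_mono ?_) ?_
      · intro u hu
        obtain ⟨i, rfl⟩ := hu.nonempty
        exact hρ.mem_V i
      · intro c' hc'
        rw [he] at hc'
        obtain ⟨j, rfl⟩ := hc'
        have hinj : Function.Injective fun l => k (Nat.pair j l) := fun l l' hl => by
          have := hk.injective hl
          exact (Nat.pair_eq_pair.1 this).2
        have hmaps : ∀ l, ρ (k (Nat.pair j l)) ∈ G.colourClass (e j) := fun l => by
          simpa using hkT (Nat.pair j l)
        have hcf : (G.colourClass (e j)).Finite := G.arena.finite_V.subset (hT j)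
        -- Otherwise each of the finitely many positions of this colour is visited finitely often.
        by_contra hnot
        refine Set.infinite_range_of_injective hinj ((hcf.biUnion (t := fun u => {i | ρ i = u})
          fun u hu => ?_).subset ?_)
        · by_contra hinf
          exact hnot ⟨u, hinf, hu.2⟩
        · rintro _ ⟨l, rfl⟩
          exact Set.mem_biUnion (hmaps l) rfl
    rw [WinsPlay, hcol]
    exact hσ

/-! ### Determinacy and the trichotomy -/

/-- Finite coloured Muller games are determined. -/
theorem determined (G : ColouredMullerGame α C) {v : α} (hv : v ∈ G.V) (σ : Bool) :
    v ∈ G.Win σ ∨ v ∈ G.Win (!σ) := by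
  induction hcard : G.V.ncard using Nat.strong_induction_on generalizing G v σ with
  | _ N ih =>
    subst hcard
    have hdet : ∀ (τ : Bool) (T : Set α), T.Nonempty → T ⊆ G.V → ∀ u ∈ (G.outsideAttr τ T).V, ∀ σ,
        u ∈ (G.outsideAttr τ T).Win σ ∨ u ∈ (G.outsideAttr τ T).Win (!σ) := by
      rintro τ T ⟨t, ht⟩ hT u hu σ
      refine ih _ (Set.ncard_lt_ncard ?_ G.arena.finite_V) _ hu σ rfl
      rw [outsideAttr_V]
      exact ⟨Set.sdiff_subset, fun hsub => (hsub (hT ht)).2 (G.arena.subset_attr τ T ht)⟩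
    wlog hσ : G.c '' G.V ∈ G.F σ generalizing σ with H
    · have hu : G.c '' G.V ∈ G.F false ∪ G.F true := by rw [G.union_F]; trivial
      have : G.c '' G.V ∈ G.F (!σ) := by
        cases σ
        · exact hu.resolve_left hσ
        · exact hu.resolve_right hσ
      have := H (!σ) this
      rw [Bool.not_not] at this
      exact this.symm
    by_cases hW : (G.Win (!σ)).Nonempty
    · have hsub := G.attr_union_Win_subset (subset_refl (G.Win (!σ)))
      by_cases hat : v ∈ G.arena.attr (!σ) (G.Win (!σ))
      · exact Or.inr (hsub (Or.inl hat))
      · rcases hdet (!σ) _ hW (G.Win_subset_V _) v (by rw [outsideAttr_V]; exact ⟨hv, hat⟩) σ with h | h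
        · left
          have := G.Win_not_outsideAttr_subset (!σ) (G.Win (!σ))
          rw [Bool.not_not] at this
          exact this h
        · exact Or.inr (hsub (Or.inr h))
    · left
      have hfull : G.FullyWins σ := by
        refine G.fullyWins_of_colours hσ ?_
        rintro c' ⟨t, ht, htc⟩
        refine Set.Subset.antisymm (Win_subset_V _ σ) fun u hu => ?_
        refine (hdet σ (G.colourClass c') ⟨t, ht, htc⟩ (fun x hx => hx.1) u hu σ).resolve_right fun h => ?_
        -- The complement of a σ-attractor traps σ, so an opponent's win there would be a win in
        -- `G`.
        exact hW ⟨u, G.Win_not_outsideAttr_subset σ _ h⟩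
      rw [hfull]
      exact hv

/-- Necessity of the conditions in both (1) and (2). -/
theorem FullyWins.outsideAttr {G : ColouredMullerGame α C} {σ : Bool} (h : G.FullyWins σ)
    (T : Set α) : (G.outsideAttr σ T).FullyWins σ := by
  refine Set.Subset.antisymm (Win_subset_V _ σ) ?_
  rw [outsideAttr_V, ← h]
  exact G.Win_diff_attr_subset σ T

/-- The subgame is empty; this absorbs the first alternative of each condition. -/
theorem fullyWins_outsideAttr_of_attr_eq {σ : Bool} {T : Set α} (h : G.arena.attr σ T = G.V)
    (τ : Bool) : (G.outsideAttr σ T).FullyWins τ := by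
  refine Set.Subset.antisymm (Win_subset_V _ τ) ?_
  rw [outsideAttr_V, h, Set.sdiff_self]
  exact Set.empty_subset _

end ColouredMullerGame

end RegularGame

theorem mainTheorem9 {α C : Type*} (G : RegularGame.ColouredMullerGame α C) (σ : Bool)
    (hσ : G.c '' G.V ∈ G.F σ) :
    -- player `σ` fully wins iff the condition on the colours holds
    (G.FullyWins σ ↔
      ∀ c' ∈ G.c '' G.V, G.arena.attr σ (G.colourClass c') = G.V ∨
        (G.outsideAttr σ (G.colourClass c')).FullyWins σ) ∧
    -- otherwise, the opponent fully wins iff the condition on the single vertices holds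
    (¬ (∀ c' ∈ G.c '' G.V, G.arena.attr σ (G.colourClass c') = G.V ∨
        (G.outsideAttr σ (G.colourClass c')).FullyWins σ) →
      (G.FullyWins (!σ) ↔
        ∀ v ∈ G.V, G.arena.attr (!σ) {v} = G.V ∨
          (G.outsideAttr (!σ) {v}).FullyWins (!σ))) ∧
    -- otherwise, no player fully wins
    (¬ (∀ c' ∈ G.c '' G.V, G.arena.attr σ (G.colourClass c') = G.V ∨
        (G.outsideAttr σ (G.colourClass c')).FullyWins σ) →
      ¬ (∀ v ∈ G.V, G.arena.attr (!σ) {v} = G.V ∨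
          (G.outsideAttr (!σ) {v}).FullyWins (!σ)) →
      G.NoPlayerFullyWins) := by

  have h1 : G.FullyWins σ ↔
      ∀ c' ∈ G.c '' G.V, G.arena.attr σ (G.colourClass c') = G.V ∨
        (G.outsideAttr σ (G.colourClass c')).FullyWins σ :=
    ⟨fun h _ _ => Or.inr (h.outsideAttr _), fun h => G.fullyWins_of_colours hσ fun c' hc' =>
      (h c' hc').elim (fun h => G.fullyWins_outsideAttr_of_attr_eq h σ) id⟩
  have h2 : ¬ G.FullyWins σ → (G.FullyWins (!σ) ↔
      ∀ v ∈ G.V, G.arena.attr (!σ) {v} = G.V ∨ (G.outsideAttr (!σ) {v}).FullyWins (!σ)) := by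
    refine fun hn => ⟨fun h _ _ => Or.inr (h.outsideAttr _), fun h => ?_⟩
    have hsub := G.Win_subset_V σ
    obtain ⟨v, hv, hvn⟩ := Set.exists_of_ssubset (hsub.ssubset_of_ne hn)
    have hvw := (G.determined hv σ).resolve_left hvn
    refine Set.Subset.antisymm (G.Win_subset_V _) fun u hu =>
      G.attr_union_Win_subset (Set.singleton_subset_iff.2 hvw) ?_
    by_cases hat : u ∈ G.arena.attr (!σ) {v}
    · exact Or.inl hat
    · have hfull := (h v hv).elim (fun h => G.fullyWins_outsideAttr_of_attr_eq h (!σ)) id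
      right
      rw [hfull, G.outsideAttr_V]
      exact ⟨hu, hat⟩
  refine ⟨h1, fun hn => h2 (mt h1.1 hn), fun hn hn' τ => ?_⟩
  rcases Bool.eq_or_eq_not τ σ with rfl | rfl
  · exact mt h1.1 hn
  · exact mt (h2 (mt h1.1 hn)).1 hn'
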